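/- Let $(\mathcal X,d)$ be a metric space (for instance a Riemannian manifold) with its Borel $\sigma$-algebra, $f:\mathcal X\to\mathcal X$ a measurable map and $\mathbb P$ an $f$-invariant Borel probability measure. For a measurable set $A$ let $r_A(x)=\min\{j\ge 1: f^j(x)\in A\}\in\mathbb N\cup\{\infty\}$ (with $\min\emptyset=\infty$) and $R(A)=\inf_{x\in A} r_A(x)$ (with $R(\emptyset)=\infty$). Let $\mathcal C$ be a Banach space of real-valued measurable functions on $\mathcal X$, and suppose that the system has decay of correlations of observables in $\mathcal C$ against $L^1(\mathbb P)$ with rate $\gamma$: there is a non-increasing $\gamma:\{1,2,\dots\}\to\mathbb R$ with $\gamma(n)\to0$ such that $$\frac{1}{\|\phi\|_{\mathcal C}\,\|\psi\|_{1}}\left|\int \phi\,(\psi\circ f^n)\,d\mathbb P-\int\phi\,d\mathbb P\int\psi\,d\mathbb P\right|\le\gamma(n)$$ for all $n\ge1$ and all non-zero $\phi\in\mathcal C$, $\psi\in L^1(\mathbb P)$ for which these integrals converge. Suppose that $n^{1+\delta}\gamma(n)\to0$ as $n\to\infty$ for some $\delta>0$. Let $\zeta\in\mathcal X$, let $B_\varepsilon=B_\varepsilon(\zeta)$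 be the open ball of radius $\varepsilon$ around $\zeta$, and suppose that $\mathbb P(B_\varepsilon)>0$ for all $\varepsilon>0$. Put $A^{(0)}_\varepsilon=B_\varepsilon$ and $A^{(j)}_\varepsilon=B_\varepsilon\cap\bigcap_{i=1}^{j}f^{-i}(\mathcal X\setminus B_\varepsilon)$ for $j\ge1$. Suppose that there is $j\ge0$ with $\lim_{\varepsilon\to0}R(A^{(j)}_\varepsilon)=\infty$, let $q$ be the least such $j$, and write $A_\varepsilon=A^{(q)}_\varepsilon$. Suppose that $\mathbf 1_{A_\varepsilon}\in\mathcal C$ for all $\varepsilon>0$, that there is $M$ with $\|\mathbf 1_{A_\varepsilon}\|_{\mathcal C}\le M$ for all $\varepsilon>0$, and that the limit (the extremal index) $$\theta=\lim_{\varepsilon\to0}\frac{\mathbb P(A_\varepsilon)}{\mathbb P(B_\varepsilon)}$$ exists. Then $$\liminf_{\varepsilon\to0}\ \frac{1}{\mathbb P(B_\varepsilon)}\left(-\limsup_{t\to\infty}\frac1t\log\mathbb P\big(r_{B_\varepsilon}>t\big)\right)\ \ge\ \theta ,$$ where $t$ runs through the positive integers, $\log 0=-\infty$, and the left-hand side may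 be $+\infty$. -/

import Mathlib

open MeasureTheory Filter Topology
open scoped ENNReal

noncomputable section

namespace ZeroHole

variable {X : Type*}

/-- First hitting time `r_A(x) = min {j ≥ 1 : f^j(x) ∈ A}`, equal to `∞` if there is no such `j`. -/
def hittingTime (f : X → X) (A : Set X) (x : X) : ℕ∞ :=
  ⨅ (j : ℕ) (_ : 1 ≤ j ∧ f^[j] x ∈ A), (j : ℕ∞)

/-- First return time of a set, `R(A) = inf_{x ∈ A} r_A(x)` (with `R(∅) = ∞`). -/
def firstReturnTime (f : X → X) (A : Set X) : ℕ∞ :=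
  ⨅ x ∈ A, hittingTime f A x

/-- `A^{(q)}(B)`: the points of `B` whose iterates at times `1, …, q` are all outside `B`.
For `q = 0` this is `B`. -/
def annulus (f : X → X) (B : Set X) (q : ℕ) : Set X :=
  B ∩ ⋂ i ∈ Set.Icc 1 q, f^[i] ⁻¹' Bᶜ

/-- The correlation
`|∫ φ (ψ ∘ f^n) dP - ∫ φ dP ∫ ψ dP| / (‖φ‖_C ‖ψ‖_1)` of an observable `φ` in the Banach space `C`
and an observable `ψ` in `L¹(P)`. The map `ι` sends an element of `C` to the real valued measurable
function (up to `P`-almost everywhere equality) that it is. -/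
def correlation [MeasurableSpace X] (P : Measure X) (f : X → X)
    {C : Type*} [NormedAddCommGroup C] [NormedSpace ℝ C] (ι : C →ₗ[ℝ] (X →ₘ[P] ℝ))
    (φ : C) (ψ : X → ℝ) (n : ℕ) : ℝ :=
  |(∫ x, ι φ x * ψ (f^[n] x) ∂P) - (∫ x, ι φ x ∂P) * (∫ x, ψ x ∂P)| /
    (‖φ‖ * ∫ x, |ψ x| ∂P)

/-- Decay of correlations of observables in `C` against observables in `L¹(P)`, with rate function
`γ` on the positive integers: `γ` is non-increasing, tends to zero and bounds every correlation
that is defined, i.e. whose integrals converge. If `φ = 0` or `‖ψ‖_1 = 0`, the quotient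
`correlation` is zero, and since `γ n ≥ 0` the bound then says nothing. -/
structure HasDecayAgainstL1 [MeasurableSpace X] (P : Measure X) (f : X → X)
    {C : Type*} [NormedAddCommGroup C] [NormedSpace ℝ C] (ι : C →ₗ[ℝ] (X →ₘ[P] ℝ))
    (γ : ℕ → ℝ) : Prop where
  antitone : AntitoneOn γ (Set.Ici 1)
  tendsto_zero : Tendsto γ atTop (𝓝 0)
  correlation_le : ∀ (φ : C) (ψ : X → ℝ) (n : ℕ), 1 ≤ n →
    Integrable (ι φ) P → Integrable ψ P → Integrable (fun x => ι φ x * ψ (f^[n] x)) P →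
    correlation P f ι φ ψ n ≤ γ n

/-- The (lower) escape rate `-limsup_{t → ∞} (1/t) log P(r_B > t)` through the hole `B`, as an
extended real number; here `log 0 = -∞`. -/
def escapeRate [MeasurableSpace X] (P : Measure X) (f : X → X) (B : Set X) : EReal :=
  -limsup (fun t : ℕ =>
    ((1 / (t : ℝ) : ℝ) : EReal) * ENNReal.log (P {x | (t : ℕ∞) < hittingTime f B x})) atTop

end ZeroHole

end

open MeasureTheory Filter Topology

/-! Since `A ⊆ B`, an orbit that misses `B` misses the annulus `A`, so it suffices to bound the
survivors of `A`, whose early returns are excluded. Decay against `L¹` has an error proportional to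
`P V`. With `V` the set of survivors after a gap, one block of times therefore costs a
multiplicative factor, and blocks can be iterated. Let `a = P A`. Take blocks of length `K g` and
gaps of length `g ≈ 1 / (K² a)`. A block then meets `A` about `1 / K` times on average, so
Bonferroni loses little to double visits. The gap error `γ g` is small against `a` because `n γ n →
0`. Close double visits do not occur, and the remaining ones are controlled by a tail of `∑ γ`. The
factor is at most `exp (-(g a (K - 5)))` per time `(K + 1) g` (`measureReal_survivors_add_le`,
`one_sub_block_le`), which gives the rate `a (K - 5) / (K + 1)`. Dividing by `P B` and letting `K`
grow yields `θ`. -/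

namespace ZeroHole

variable {X : Type*}

/-! ### Quasi-independence of indicators, and Bonferroni -/

section Indicator

variable [MeasurableSpace X] {P : Measure X} {f : X → X}

lemma measureReal_preimage_iterate (hf : MeasurePreserving f P P) (n : ℕ) {V : Set X}
    (hV : MeasurableSet V) : P.real (f^[n] ⁻¹' V) = P.real V := by
  simp only [Measure.real]
  rw [(hf.iterate n).measure_preimage hV.nullMeasurableSet]

lemma HasDecayAgainstL1.nonneg {C : Type*} [NormedAddCommGroup C] [NormedSpace ℝ C]
    {ι : C →ₗ[ℝ] (X →ₘ[P] ℝ)} {γ : ℕ → ℝ} (h : HasDecayAgainstL1 P f ι γ) {n : ℕ} (hn : 1 ≤ n) :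
    0 ≤ γ n := by
  refine le_of_tendsto h.tendsto_zero ?_
  filter_upwards [eventually_ge_atTop n] with m hm
  exact h.antitone (Set.mem_Ici.2 hn) (Set.mem_Ici.2 (hn.trans hm)) hm

/-- Decay of correlations, for the indicators of two sets. -/
lemma HasDecayAgainstL1.abs_measureReal_inter_sub_le [IsProbabilityMeasure P]
    (hf : MeasurePreserving f P P)
    {C : Type*} [NormedAddCommGroup C] [NormedSpace ℝ C]
    {ι : C →ₗ[ℝ] (X →ₘ[P] ℝ)} {γ : ℕ → ℝ} (h : HasDecayAgainstL1 P f ι γ)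
    {A V : Set X} (hA : MeasurableSet A) (hV : MeasurableSet V) {M : ℝ} {φ : C}
    (hφ : ι φ =ᵐ[P] A.indicator (fun _ => (1 : ℝ))) (hφM : ‖φ‖ ≤ M) {n : ℕ} (hn : 1 ≤ n) :
    |P.real (A ∩ f^[n] ⁻¹' V) - P.real A * P.real V| ≤ M * γ n * P.real V := by
  have hγ := h.nonneg hn
  have hM : 0 ≤ M := (norm_nonneg _).trans hφM
  have hnV : MeasurableSet (f^[n] ⁻¹' V) := (hf.iterate n).measurable hV
  set ψ : X → ℝ := V.indicator (fun _ => (1 : ℝ)) with hψ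
  have hprod : (fun x => ι φ x * ψ (f^[n] x)) =ᵐ[P]
      (A ∩ f^[n] ⁻¹' V).indicator (fun _ => (1 : ℝ)) := by
    filter_upwards [hφ] with x hx
    rw [hx]
    by_cases h1 : x ∈ A <;> by_cases h2 : f^[n] x ∈ V <;> simp [hψ, h1, h2]
  have hint : ∀ {S : Set X}, MeasurableSet S →
      Integrable (S.indicator (fun _ => (1 : ℝ))) P := fun hS =>
    (integrable_const (1 : ℝ)).indicator hS
  have hcor := h.correlation_le φ ψ n hn ((hint hA).congr hφ.symm) (hint hV)
    ((hint (hA.inter hnV)).congr hprod.symm)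
  have habs : (fun x => |ψ x|) = ψ := by
    funext x
    exact abs_of_nonneg (Set.indicator_nonneg (fun _ _ => zero_le_one) x)
  have hI : ∀ {S : Set X}, MeasurableSet S →
      ∫ x, S.indicator (fun _ => (1 : ℝ)) x ∂P = P.real S := fun hS => by
    rw [integral_indicator_const _ hS]; simp
  unfold correlation at hcor
  rw [integral_congr_ae hprod, integral_congr_ae hφ, habs, hI hA, hI hV, hI (hA.inter hnV)] at hcor
  -- If `P V = 0` or `φ = 0`, the quotient in `hcor` is the default value `0` and carries no
  -- information. In both cases the sets involved are null.
  rcases eq_or_lt_of_le (measureReal_nonneg (μ := P) (s := V)) with hV0 | hV0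
  · have : P.real (A ∩ f^[n] ⁻¹' V) = 0 := by
      refine le_antisymm ?_ measureReal_nonneg
      calc P.real (A ∩ f^[n] ⁻¹' V) ≤ P.real (f^[n] ⁻¹' V) := measureReal_mono Set.inter_subset_right
        _ = 0 := by rw [measureReal_preimage_iterate hf n hV, ← hV0]
    rw [this, ← hV0]; simp
  rcases eq_or_lt_of_le (norm_nonneg φ) with h0 | h0
  · have hφ0 : φ = 0 := norm_eq_zero.1 h0.symm
    have hA0 : P.real A = 0 := by
      rw [← hI hA, ← integral_congr_ae hφ, hφ0, map_zero, integral_congr_ae AEEqFun.coeFn_zero]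
      simp
    have : P.real (A ∩ f^[n] ⁻¹' V) = 0 :=
      le_antisymm (hA0 ▸ measureReal_mono Set.inter_subset_left) measureReal_nonneg
    rw [this, hA0]; simp only [zero_mul, sub_zero, abs_zero]; positivity
  · rw [div_le_iff₀ (by positivity)] at hcor
    calc _ ≤ γ n * (‖φ‖ * P.real V) := hcor
      _ ≤ γ n * (M * P.real V) := by gcongr
      _ = _ := by ring

/-- A Bonferroni inequality. -/
lemma measureReal_inter_avoid_le [IsFiniteMeasure P] {E : ℕ → Set X}
    (hE : ∀ i, MeasurableSet (E i)) (V : Set X) (n : ℕ) :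
    P.real (V ∩ {x | ∀ i < n, x ∉ E i}) ≤ P.real V -
      ∑ i ∈ Finset.range n, (P.real (E i ∩ V) - ∑ j ∈ Finset.range i, P.real (E j ∩ E i ∩ V)) := by
  induction n with
  | zero => simp
  | succ n ih =>
    set S := V ∩ {x | ∀ i < n, x ∉ E i} with hS
    have h1 : V ∩ {x | ∀ i < n + 1, x ∉ E i} = S \ E n := by
      ext x
      simp only [hS, Set.mem_inter_iff, Set.mem_ofPred_eq, Set.mem_sdiff, Nat.lt_succ_iff_lt_or_eq]
      constructor
      · rintro ⟨hv, h⟩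
        exact ⟨⟨hv, fun i hi => h i (Or.inl hi)⟩, h n (Or.inr rfl)⟩
      · rintro ⟨⟨hv, h⟩, hn⟩
        refine ⟨hv, ?_⟩
        rintro i (hi | rfl)
        exacts [h i hi, hn]
    -- A point of `E n ∩ V` either avoids all earlier `E j`, hence lies in `S`, or is counted in
    -- some pair intersection.
    have h2 : P.real (E n ∩ V) ≤
        P.real (S ∩ E n) + ∑ j ∈ Finset.range n, P.real (E j ∩ E n ∩ V) := by
      have hsub : E n ∩ V ⊆ (S ∩ E n) ∪ ⋃ j ∈ Finset.range n, E j ∩ E n ∩ V := by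
        rintro x ⟨hxn, hxV⟩
        by_cases h : ∀ i < n, x ∉ E i
        · exact Or.inl ⟨⟨hxV, h⟩, hxn⟩
        · push Not at h
          obtain ⟨i, hi, hxi⟩ := h
          exact Or.inr (Set.mem_biUnion (Finset.mem_coe.2 (Finset.mem_range.2 hi))
            ⟨⟨hxi, hxn⟩, hxV⟩)
      calc _ ≤ _ := measureReal_mono hsub
        _ ≤ _ := measureReal_union_le _ _
        _ ≤ _ := by gcongr; exact measureReal_biUnion_finset_le _ _
    have h3 := measureReal_inter_add_sdiff (μ := P) (s := S) (hE n)
    rw [h1, Finset.sum_range_succ]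
    linarith

end Indicator

/-! ### Survivors and the one-block estimate -/

/-- The points whose orbit avoids `A` at the times `0, …, t - 1`. -/
def survivors (f : X → X) (A : Set X) (t : ℕ) : Set X := {x | ∀ i < t, f^[i] x ∉ A}

section Survivors

variable {f : X → X}

lemma survivors_anti (f : X → X) (A : Set X) {s t : ℕ} (h : s ≤ t) :
    survivors f A t ⊆ survivors f A s := fun _ hx i hi => hx i (hi.trans_le h)

/-- Hitting times start at `1` and survivors at time `0`; the preimage under `f` absorbs this shift,
and invariance makes it free. -/
lemma setOf_lt_hittingTime_subset {A B : Set X} (hAB : A ⊆ B) (t : ℕ) :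
    {x | (t : ℕ∞) < hittingTime f B x} ⊆ f ⁻¹' survivors f A t := by
  intro x hx i hi hA
  have hx' : (t : ℕ∞) < hittingTime f B x := hx
  have h1 : hittingTime f B x ≤ ((i + 1 : ℕ) : ℕ∞) :=
    iInf₂_le (i + 1) ⟨by omega, by rw [Function.iterate_succ_apply]; exact hAB hA⟩
  have := hx'.trans_le h1
  norm_cast at this
  omega

lemma inter_preimage_eq_empty_of_lt_firstReturnTime {A : Set X} {N n : ℕ}
    (h : (N : ℕ∞) ≤ firstReturnTime f A) (h1 : 1 ≤ n) (hn : n < N) : A ∩ f^[n] ⁻¹' A = ∅ := by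
  refine Set.eq_empty_iff_forall_notMem.2 fun x hx => ?_
  have h2 : firstReturnTime f A ≤ (n : ℕ∞) :=
    (iInf₂_le x hx.1).trans (iInf₂_le n ⟨h1, hx.2⟩)
  have := h.trans h2
  norm_cast at this
  omega

variable [MeasurableSpace X] {P : Measure X}

lemma measurableSet_survivors (hf : Measurable f) {A : Set X} (hA : MeasurableSet A) (t : ℕ) :
    MeasurableSet (survivors f A t) := by
  have : survivors f A t = ⋂ i ∈ Set.Iio t, (f^[i] ⁻¹' A)ᶜ := by
    ext x; simp [survivors]
  rw [this]
  exact MeasurableSet.biInter (Set.to_countable _) fun i _ => ((hf.iterate i) hA).compl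

lemma measureReal_preimage_inter_preimage (hf : MeasurePreserving f P P) {A V : Set X}
    (hA : MeasurableSet A) (hV : MeasurableSet V) {i n : ℕ} (h : i ≤ n) :
    P.real (f^[i] ⁻¹' A ∩ f^[n] ⁻¹' V) = P.real (A ∩ f^[n - i] ⁻¹' V) := by
  have : f^[i] ⁻¹' A ∩ f^[n] ⁻¹' V = f^[i] ⁻¹' (A ∩ f^[n - i] ⁻¹' V) := by
    rw [Set.preimage_inter, ← Set.preimage_comp, ← Function.iterate_add, Nat.sub_add_cancel h]
  rw [this, measureReal_preimage_iterate hf i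
    (hA.inter ((hf.measurable.iterate (n - i)) hV))]

/-- Avoiding `A` during a block of length `s` followed by a gap of length `g` costs a factor,
controlled by the quasi-independence `hmix` and by the absence of returns before time `N`. -/
lemma measureReal_survivors_add_le [IsProbabilityMeasure P] (hf : MeasurePreserving f P P)
    {A : Set X} (hA : MeasurableSet A) {β : ℕ → ℝ} (hβ0 : ∀ n, 1 ≤ n → 0 ≤ β n)
    (hβ : AntitoneOn β (Set.Ici 1))
    (hmix : ∀ V : Set X, MeasurableSet V → ∀ n, 1 ≤ n →
      |P.real (A ∩ f^[n] ⁻¹' V) - P.real A * P.real V| ≤ β n * P.real V)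
    {N : ℕ} (hN : 1 ≤ N) (hret : ∀ n, 1 ≤ n → n < N → A ∩ f^[n] ⁻¹' A = ∅)
    {τ : ℝ} (hτ : ∀ n, ∑ k ∈ Finset.Ico N n, β k ≤ τ) (s t : ℕ) {g : ℕ} (hg : 1 ≤ g) :
    P.real (survivors f A (s + g + t)) ≤
      (1 - s * (P.real A - β g) + s * ((s * P.real A + τ) * (P.real A + β g))) *
        P.real (survivors f A t) := by
  set a := P.real A with ha
  set W := survivors f A t
  set w := P.real W
  have hW : MeasurableSet W := measurableSet_survivors hf.measurable hA t
  have ha0 : 0 ≤ a := measureReal_nonneg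
  have hw0 : 0 ≤ w := measureReal_nonneg
  have hg0 := hβ0 g hg
  have hβg : ∀ {n}, g ≤ n → β n ≤ β g := fun {n} hn =>
    hβ (Set.mem_Ici.2 hg) (Set.mem_Ici.2 (hg.trans hn)) hn
  have hmeas : ∀ n {S : Set X}, MeasurableSet S → MeasurableSet (f^[n] ⁻¹' S) :=
    fun n S hS => (hf.measurable.iterate n) hS
  set V := f^[s + g] ⁻¹' W with hVdef
  -- The constraints at the gap times `s, …, s + g - 1` are discarded.
  have hsub : survivors f A (s + g + t) ⊆ V ∩ {x | ∀ i < s, x ∉ f^[i] ⁻¹' A} := by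
    intro x hx
    refine ⟨fun i hi => ?_, fun i hi => hx i (by omega)⟩
    rw [← Function.iterate_add_apply]
    exact hx _ (by omega)
  have hbon := measureReal_inter_avoid_le (P := P) (E := fun i => f^[i] ⁻¹' A)
    (fun i => hmeas i hA) V s
  have hVw : P.real V = w := measureReal_preimage_iterate hf _ hW
  have hone : ∀ n, g ≤ n → (a - β g) * w ≤ P.real (A ∩ f^[n] ⁻¹' W) ∧
      P.real (A ∩ f^[n] ⁻¹' W) ≤ (a + β g) * w := by
    intro n hn
    have h1 := abs_le.1 (hmix W hW n (hg.trans hn))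
    have h2 : β n * w ≤ β g * w := by gcongr; exact hβg hn
    constructor <;> linarith [h1.1, h1.2]
  have hmain : ∀ i ∈ Finset.range s,
      (a - β g) * w - (s * a + τ) * ((a + β g) * w) ≤
        P.real (f^[i] ⁻¹' A ∩ V) -
          ∑ j ∈ Finset.range i, P.real (f^[j] ⁻¹' A ∩ f^[i] ⁻¹' A ∩ V) := by
    intro i hi
    have his : i < s := Finset.mem_range.1 hi
    have h1 : (a - β g) * w ≤ P.real (f^[i] ⁻¹' A ∩ V) := by
      rw [measureReal_preimage_inter_preimage hf hA hW (by omega)]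
      exact (hone _ (by omega)).1
    -- A double visit is handled by mixing twice: between the two visits, with `U` as the future
    -- set, and then across the gap, inside `U`.
    set U := A ∩ f^[s + g - i] ⁻¹' W with hU
    have hUm : MeasurableSet U := hA.inter (hmeas _ hW)
    have hUle : P.real U ≤ (a + β g) * w := (hone _ (by omega)).2
    have hUeq : f^[i] ⁻¹' A ∩ V = f^[i] ⁻¹' U := by
      rw [hU, Set.preimage_inter, ← Set.preimage_comp (f := f^[i]), ← Function.iterate_add,
        Nat.sub_add_cancel (by omega)]
    have hτ0 : 0 ≤ τ := by simpa using hτ N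
    have h2 : ∀ j ∈ Finset.range i, P.real (f^[j] ⁻¹' A ∩ f^[i] ⁻¹' A ∩ V) ≤
        (a + if N ≤ i - j then β (i - j) else 0) * ((a + β g) * w) := by
      intro j hj
      have hji : j < i := Finset.mem_range.1 hj
      rw [Set.inter_assoc, hUeq, measureReal_preimage_inter_preimage hf hA hUm hji.le]
      split_ifs with hk
      · have h3 := (abs_le.1 (hmix U hUm (i - j) (by omega))).2
        have h4 := hβ0 (i - j) (by omega)
        calc _ ≤ (a + β (i - j)) * P.real U := by linarith
          _ ≤ _ := by gcongr
      · have : A ∩ f^[i - j] ⁻¹' U = ∅ := by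
          refine Set.subset_empty_iff.1 ?_
          rw [← hret (i - j) (by omega) (by omega)]
          exact Set.inter_subset_inter_right _ (Set.preimage_mono Set.inter_subset_left)
        rw [this, measureReal_empty]
        positivity
    -- Reindexing by the time `k = i - j` between visits turns this into a piece of the tail of `β`
    -- from `N` on.
    have h5 : ∑ j ∈ Finset.range i, (if N ≤ i - j then β (i - j) else 0) ≤ τ := by
      have h6 : ∑ j ∈ Finset.range i, (if N ≤ i - j then β (i - j) else 0) =
          ∑ k ∈ Finset.Ico 1 (i + 1), (if N ≤ k then β k else 0) := by
        rw [Finset.sum_Ico_eq_sum_range, ← Finset.sum_range_reflect]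
        refine Finset.sum_congr (by simp) fun j hj => ?_
        have : i - (i - 1 - j) = 1 + j := by
          have := Finset.mem_range.1 hj
          omega
        rw [this]
      rw [h6, ← Finset.sum_filter]
      have h7 : (Finset.Ico 1 (i + 1)).filter (fun k => N ≤ k) = Finset.Ico N (i + 1) := by
        ext k; simp only [Finset.mem_filter, Finset.mem_Ico]; omega
      rw [h7]
      exact hτ _
    have h8 : ∑ j ∈ Finset.range i, P.real (f^[j] ⁻¹' A ∩ f^[i] ⁻¹' A ∩ V) ≤
        (s * a + τ) * ((a + β g) * w) := by
      calc _ ≤ _ := Finset.sum_le_sum h2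
        _ = (i * a + ∑ j ∈ Finset.range i, (if N ≤ i - j then β (i - j) else 0)) *
            ((a + β g) * w) := by
          rw [← Finset.sum_mul, Finset.sum_add_distrib]; simp
        _ ≤ _ := by gcongr
    linarith
  have hsum := Finset.card_nsmul_le_sum _ _ _ hmain
  rw [Finset.card_range, nsmul_eq_mul] at hsum
  have := (measureReal_mono hsub).trans hbon
  rw [hVw] at this
  linarith

/-! ### From block estimates to escape rates -/

/-- A geometric bound along the multiples of `L` gives an exponential bound. -/
lemma measureReal_survivors_le_exp [IsProbabilityMeasure P] {A : Set X} {L : ℕ} (hL : 1 ≤ L)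
    {c : ℝ} (hc : 0 ≤ c)
    (h : ∀ t, P.real (survivors f A (L + t)) ≤ Real.exp (-c) * P.real (survivors f A t)) (t : ℕ) :
    P.real (survivors f A t) ≤ Real.exp (c - c / L * t) := by
  have hk : ∀ k : ℕ, P.real (survivors f A (k * L)) ≤ Real.exp (-(c * k)) := by
    intro k
    induction k with
    | zero => simp
    | succ k ih =>
      rw [Nat.succ_mul, add_comm]
      calc _ ≤ _ := h _
        _ ≤ Real.exp (-c) * Real.exp (-(c * k)) := by gcongr
        _ = _ := by rw [← Real.exp_add]; congr 1; push_cast; ring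
  calc _ ≤ P.real (survivors f A (t / L * L)) :=
        measureReal_mono (survivors_anti f A (Nat.div_mul_le_self t L))
    _ ≤ _ := hk _
    _ ≤ _ := by
      rw [Real.exp_le_exp]
      have hL0 : (0 : ℝ) < L := by exact_mod_cast hL
      -- The incomplete last block is ignored; this is the source of the additive `c` in the
      -- exponent.
      have h1 : (t : ℝ) ≤ ((t / L : ℕ) + 1) * L := by
        have := (Nat.lt_mul_div_succ t hL).le
        rw [mul_comm] at this
        exact_mod_cast this
      have h2 : (t : ℝ) / L ≤ (t / L : ℕ) + 1 := by rwa [div_le_iff₀ hL0]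
      have h3 : c * (t / L) ≤ c * ((t / L : ℕ) + 1) := by gcongr
      have h4 : c / L * t = c * (t / L) := by ring
      linarith

/-- The prefactor `exp c` disappears in the limit, as `c / t → 0`. -/
lemma le_escapeRate {B : Set X} {c lam : ℝ}
    (h : ∀ t : ℕ, P {x | (t : ℕ∞) < hittingTime f B x} ≤ ENNReal.ofReal (Real.exp (c - lam * t))) :
    (lam : EReal) ≤ escapeRate P f B := by
  rw [escapeRate, EReal.le_neg]
  have hlim : Tendsto (fun t : ℕ => ((1 / (t : ℝ) * c - lam : ℝ) : EReal)) atTop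
      (𝓝 ((-lam : ℝ) : EReal)) := by
    refine (continuous_coe_real_ereal.tendsto _).comp ?_
    have := (tendsto_one_div_atTop_nhds_zero_nat (𝕜 := ℝ)).mul_const c
    simpa using this.sub_const lam
  rw [← EReal.coe_neg, ← hlim.limsup_eq]
  refine limsup_le_limsup ?_
  filter_upwards [eventually_ge_atTop 1] with t ht
  have ht0 : (0 : ℝ) < t := by exact_mod_cast ht
  have hlog : ENNReal.log (P {x | (t : ℕ∞) < hittingTime f B x}) ≤ ((c - lam * t : ℝ) : EReal) := by
    calc _ ≤ _ := ENNReal.log_monotone (h t)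
      _ = _ := by rw [ENNReal.log_ofReal_of_pos (Real.exp_pos _), Real.log_exp]
  calc _ ≤ ((1 / (t : ℝ) : ℝ) : EReal) * ((c - lam * t : ℝ) : EReal) :=
        mul_le_mul_of_nonneg_left hlog (by exact_mod_cast (by positivity : (0 : ℝ) ≤ 1 / (t : ℝ)))
    _ = _ := by
        rw [← EReal.coe_mul]; congr 1; field_simp

lemma escapeRate_nonneg [IsProbabilityMeasure P] (B : Set X) : 0 ≤ escapeRate P f B := by
  have := le_escapeRate (P := P) (f := f) (B := B) (c := 0) (lam := 0)
    (fun t => by simpa using prob_le_one)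
  simpa using this

/-- An exponential bound for the survivors of `A ⊆ B` bounds the escape rate through `B`. -/
lemma le_escapeRate_of_survivors [IsProbabilityMeasure P] (hf : MeasurePreserving f P P)
    {A B : Set X} (hA : MeasurableSet A) (hAB : A ⊆ B) {c lam : ℝ}
    (h : ∀ t : ℕ, P.real (survivors f A t) ≤ Real.exp (c - lam * t)) :
    (lam : EReal) ≤ escapeRate P f B := by
  refine le_escapeRate (c := c) fun t => ?_
  calc _ ≤ _ := measure_mono (setOf_lt_hittingTime_subset hAB t)
    _ = P (survivors f A t) :=
      hf.measure_preimage (measurableSet_survivors hf.measurable hA t).nullMeasurableSet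
    _ = ENNReal.ofReal (P.real (survivors f A t)) := by simp
    _ ≤ _ := ENNReal.ofReal_le_ofReal (h t)

end Survivors

/-! ### Choice of scales for small balls -/

lemma measurableSet_annulus [MeasurableSpace X] {f : X → X} (hf : Measurable f) {B : Set X}
    (hB : MeasurableSet B) (q : ℕ) : MeasurableSet (annulus f B q) :=
  hB.inter (MeasurableSet.biInter (Set.to_countable _) fun i _ => (hf.iterate i) hB.compl)

/-- Summability controls the double visits, and `n γ n → 0` controls the mixing error across a gap
of length comparable to `1 / a`. -/
lemma summable_and_tendsto_mul_of_rpow {γ : ℕ → ℝ} {δ : ℝ} (hδ : 0 < δ)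
    (hγ0 : ∀ n, 1 ≤ n → 0 ≤ γ n)
    (hγ : Tendsto (fun n : ℕ => (n : ℝ) ^ (1 + δ) * γ n) atTop (𝓝 0)) :
    Summable γ ∧ Tendsto (fun n : ℕ => (n : ℝ) * γ n) atTop (𝓝 0) := by
  constructor
  · refine summable_of_isBigO_nat (Real.summable_nat_rpow_inv.2 (by linarith : 1 < 1 + δ)) ?_
    refine Asymptotics.IsBigO.of_bound 1 ?_
    filter_upwards [hγ.eventually_le_const zero_lt_one, eventually_ge_atTop 1] with n h1 hn
    have hn0 : (0 : ℝ) < n := by exact_mod_cast hn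
    have hp : 0 < (n : ℝ) ^ (1 + δ) := by positivity
    rw [Real.norm_of_nonneg (hγ0 n hn), Real.norm_of_nonneg (by positivity), one_mul,
      ← one_div, le_div_iff₀ hp, mul_comm]
    exact h1
  · refine squeeze_zero' ?_ ?_ hγ
    · filter_upwards [eventually_ge_atTop 1] with n hn
      have := hγ0 n hn
      positivity
    · filter_upwards [eventually_ge_atTop 1] with n hn
      have := hγ0 n hn
      have h1 : (1 : ℝ) ≤ n := by exact_mod_cast hn
      gcongr
      calc (n : ℝ) = (n : ℝ) ^ (1 : ℝ) := (Real.rpow_one _).symm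
        _ ≤ _ := Real.rpow_le_rpow_of_exponent_le h1 (by linarith)

/-- Numerical form of the one-step estimate with blocks of length `K g` and gaps of length `g`. -/
lemma one_sub_block_le {a b τ g K : ℝ} (ha : 0 ≤ a) (hb : 0 ≤ b) (hg : 0 ≤ g)
    (hK : 5 ≤ K)
    (hba : K * b ≤ a) (hga : K ^ 2 * (g * a) ≤ 1) (hτ : K * τ ≤ 1) :
    1 - K * g * (a - b) + K * g * ((K * g * a + τ) * (a + b)) ≤ 1 - g * a * (K - 5) := by
  have hK0 : 0 < K := by linarith
  -- The `5` in the conclusion is `4` from double visits (`h3`) plus `1` from the gap error (`h5`).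
  have h1 : K * (K * g * a + τ) ≤ 2 := by nlinarith
  have h2 : a + b ≤ 2 * a := by nlinarith
  have h3 : K * ((K * g * a + τ) * (a + b)) ≤ 4 * a := by
    calc _ = K * (K * g * a + τ) * (a + b) := by ring
      _ ≤ 2 * (2 * a) := by gcongr
      _ = _ := by ring
  have h4 : g * (K * ((K * g * a + τ) * (a + b))) ≤ g * (4 * a) := by gcongr
  have h5 : g * (K * b) ≤ g * a := by gcongr
  linarith

/-- The escape rate through `B` is at least `(K - 5) / (K + 1) * P A`, for the annuli `A` of `B`
with `B` small. -/
lemma eventually_le_escapeRate [MeasurableSpace X]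
    {P : Measure X} [IsProbabilityMeasure P] {f : X → X} (hf : MeasurePreserving f P P)
    {γ : ℕ → ℝ} (hγ0 : ∀ n, 1 ≤ n → 0 ≤ γ n) (hanti : AntitoneOn γ (Set.Ici 1))
    (hsum : Summable γ) (hnγ : Tendsto (fun n : ℕ => (n : ℝ) * γ n) atTop (𝓝 0))
    {l : Filter ℝ} {A B : ℝ → Set X} (hA : ∀ ε, MeasurableSet (A ε)) (hAB : ∀ ε, A ε ⊆ B ε)
    (hR : Tendsto (fun ε => firstReturnTime f (A ε)) l (𝓝 ⊤))
    {M : ℝ} (hM : 0 ≤ M)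
    (hmix : ∀ᶠ ε in l, ∀ V : Set X, MeasurableSet V → ∀ n, 1 ≤ n →
      |P.real (A ε ∩ f^[n] ⁻¹' V) - P.real (A ε) * P.real V| ≤ M * γ n * P.real V)
    (hpos : ∀ᶠ ε in l, 0 < P.real (A ε)) {K : ℕ} (hK : 5 ≤ K) :
    ∀ᶠ ε in l, ((P.real (A ε) * ((K - 5) / (K + 1)) : ℝ) : EReal) ≤ escapeRate P f (B ε) := by
  have hK0 : (0 : ℝ) < K := by exact_mod_cast (by omega : 0 < K)
  have hK5 : (5 : ℝ) ≤ K := by exact_mod_cast hK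
  have hRN : ∀ N : ℕ, ∀ᶠ ε in l, (N : ℕ∞) ≤ firstReturnTime f (A ε) := fun N =>
    hR.eventually_const_le (ENat.natCast_lt_top N)
  have hγlim : Tendsto (fun n => M * γ n) atTop (𝓝 0) := by
    simpa using hsum.tendsto_atTop_zero.const_mul M
  -- If `A` has no return at time `k`, mixing of `A` with itself gives `a² ≤ M γ k a`, so `a ≤ M γ
  -- k`.
  have ha : Tendsto (fun ε => P.real (A ε)) l (𝓝 0) := by
    rw [Metric.tendsto_nhds]
    intro r hr
    obtain ⟨k, hk, hk1⟩ := ((hγlim.eventually_lt_const hr).and (eventually_ge_atTop 1)).exists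
    filter_upwards [hRN (k + 1), hmix, hpos] with ε h1 h2 h3
    have h4 := (abs_le.1 (h2 (A ε) (hA ε) k hk1)).1
    rw [inter_preimage_eq_empty_of_lt_firstReturnTime h1 hk1 (by omega), measureReal_empty] at h4
    have h5 : P.real (A ε) ≤ M * γ k := by
      refine le_of_mul_le_mul_right ?_ h3
      linarith
    rw [Real.dist_eq, sub_zero, abs_of_pos h3]
    linarith
  obtain ⟨N, hN1, hN⟩ : ∃ N : ℕ, 1 ≤ N ∧
      ∀ n, ∑ k ∈ Finset.Ico N n, M * γ k ≤ 1 / K := by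
    have hs : Summable fun n => M * γ n := hsum.mul_left M
    have h1 := tendsto_sum_nat_add fun n => M * γ n
    obtain ⟨N, hN, hN1⟩ := ((h1.eventually_le_const (by positivity : (0 : ℝ) < 1 / K)).and
      (eventually_ge_atTop 1)).exists
    refine ⟨N, hN1, fun n => le_trans ?_ hN⟩
    rw [Finset.sum_Ico_eq_sum_range]
    simp_rw [add_comm N]
    refine ((summable_nat_add_iff N).2 hs).sum_le_tsum _ fun i _ => ?_
    exact mul_nonneg hM (hγ0 _ (by omega))
  have hnγM : Tendsto (fun n : ℕ => M * ((n : ℝ) * γ n)) atTop (𝓝 0) := by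
    simpa using hnγ.const_mul M
  have ha' : Tendsto (fun ε => P.real (A ε)) l (𝓝[>] 0) :=
    tendsto_nhdsWithin_iff.2 ⟨ha, hpos⟩
  -- This gap length makes `K g a ≤ 1 / K`; it grows because `a → 0`.
  have hg : Tendsto (fun ε => ⌊1 / (K ^ 2 * P.real (A ε))⌋₊) l atTop := by
    refine tendsto_nat_floor_atTop.comp ?_
    have h1 := (tendsto_inv_nhdsGT_zero.comp ha').const_mul_atTop
      (by positivity : (0 : ℝ) < 1 / K ^ 2)
    refine h1.congr fun ε => ?_
    simp only [Function.comp, one_div, mul_inv]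
  filter_upwards [hRN N, hmix, hpos, hg.eventually_ge_atTop 1,
    hg.eventually (hnγM.eventually_le_const (by positivity : (0 : ℝ) < 1 / (2 * K ^ 3)))]
    with ε h1 h2 h3 h4 h5
  set a := P.real (A ε) with ha_def
  set g := ⌊1 / (K ^ 2 * a)⌋₊ with hg_def
  have hg1 : (1 : ℝ) ≤ g := by exact_mod_cast h4
  have hgle : (g : ℝ) ≤ 1 / (K ^ 2 * a) := Nat.floor_le (by positivity)
  have hglt : 1 / (K ^ 2 * a) < g + 1 := Nat.lt_floor_add_one _
  have hga : (K : ℝ) ^ 2 * (g * a) ≤ 1 := by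
    rw [le_div_iff₀ (by positivity)] at hgle
    linarith
  -- As `g ≥ 1`, rounding down loses at most a factor `2`; this is the `2` in the threshold `1 / (2
  -- K³)` on `M g γ g`, which then yields `K M γ g ≤ a`.
  have hga2 : 1 ≤ 2 * (K : ℝ) ^ 2 * (g * a) := by
    rw [div_lt_iff₀ (by positivity)] at hglt
    have : (g + 1 : ℝ) * (K ^ 2 * a) ≤ (2 * g) * (K ^ 2 * a) := by gcongr; linarith
    linarith
  have hba : K * (M * γ g) ≤ a := by
    have hg0 : (0 : ℝ) < g := by linarith
    refine le_of_mul_le_mul_left ?_ hg0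
    rw [le_div_iff₀ (by positivity)] at h5
    have h6 : 2 * (K : ℝ) ^ 2 * (g * (K * (M * γ g))) ≤ 2 * (K : ℝ) ^ 2 * (g * a) := by
      calc _ = M * (g * γ g) * (2 * K ^ 3) := by ring
        _ ≤ 1 := h5
        _ ≤ _ := hga2
    exact le_of_mul_le_mul_left h6 (by positivity)
  have hstep : ∀ t, P.real (survivors f (A ε) ((K * g + g) + t)) ≤
      Real.exp (-(g * a * (K - 5))) * P.real (survivors f (A ε) t) := by
    intro t
    refine (measureReal_survivors_add_le hf (hA ε) (β := fun n => M * γ n)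
      (fun n hn => mul_nonneg hM (hγ0 n hn))
      (fun m hm n hn hmn => mul_le_mul_of_nonneg_left (hanti hm hn hmn) hM) h2 hN1
      (fun n hn hn' => inter_preimage_eq_empty_of_lt_firstReturnTime h1 hn hn')
      hN (K * g) t h4).trans ?_
    gcongr
    push_cast
    refine (one_sub_block_le h3.le (mul_nonneg hM (hγ0 g h4)) (by positivity)
      hK5 hba hga (by field_simp; rfl)).trans ?_
    have := Real.add_one_le_exp (-(g * a * (K - 5)))
    linarith
  have hexp := measureReal_survivors_le_exp (by omega : 1 ≤ K * g + g)
    (mul_nonneg (by positivity) (by linarith) : 0 ≤ g * a * ((K : ℝ) - 5)) hstep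
  have hlam : a * ((K - 5) / (K + 1)) = g * a * ((K : ℝ) - 5) / ((K * g + g : ℕ) : ℝ) := by
    push_cast
    have : (K : ℝ) * g + g = (K + 1) * g := by ring
    rw [this]
    field_simp
  rw [hlam]
  exact le_escapeRate_of_survivors hf (hA ε) (hAB ε) hexp

end ZeroHole

/-! ### The lower bound by the extremal index -/

theorem mainTheorem6
    {X : Type*} [MetricSpace X] [MeasurableSpace X] [BorelSpace X]
    (P : Measure X) [IsProbabilityMeasure P]
    (f : X → X) (hf : MeasurePreserving f P P)
    -- a Banach space of observables, with decay of correlations against `L¹`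
    {C : Type*} [NormedAddCommGroup C] [NormedSpace ℝ C] [CompleteSpace C]
    (ι : C →ₗ[ℝ] (X →ₘ[P] ℝ))
    (γ : ℕ → ℝ) (hdecay : ZeroHole.HasDecayAgainstL1 P f ι γ)
    (δ : ℝ) (hδ : 0 < δ)
    (hγ : Tendsto (fun n : ℕ => (n : ℝ) ^ (1 + δ) * γ n) atTop (𝓝 0))
    -- a point of the support of `P`
    (ζ : X) (hζ : ∀ ε : ℝ, 0 < ε → 0 < P (Metric.ball ζ ε))
    -- the least `q` for which the return times of `A_ε` to itself tend to infinity
    (q : ℕ)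
    (hq : IsLeast {j : ℕ | Tendsto
      (fun ε : ℝ => ZeroHole.firstReturnTime f (ZeroHole.annulus f (Metric.ball ζ ε) j))
      (𝓝[>] 0) (𝓝 ⊤)} q)
    -- the indicator of `A_ε` lies in `C` with norm at most `M`
    (M : ℝ)
    (hM : ∀ ε : ℝ, 0 < ε → ∃ φ : C,
      ι φ =ᵐ[P] (ZeroHole.annulus f (Metric.ball ζ ε) q).indicator (fun _ => (1 : ℝ)) ∧ ‖φ‖ ≤ M)
    -- the extremal index
    (θ : ℝ)
    (hθ : Tendsto
      (fun ε : ℝ => P.real (ZeroHole.annulus f (Metric.ball ζ ε) q) / P.real (Metric.ball ζ ε))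
      (𝓝[>] 0) (𝓝 θ)) :
    (θ : EReal) ≤ liminf
      (fun ε : ℝ => ((1 / P.real (Metric.ball ζ ε) : ℝ) : EReal) *
        ZeroHole.escapeRate P f (Metric.ball ζ ε))
      (𝓝[>] 0) := by
  have hγ0 : ∀ n, 1 ≤ n → 0 ≤ γ n := fun n hn => hdecay.nonneg hn
  obtain ⟨hsum, hnγ⟩ := ZeroHole.summable_and_tendsto_mul_of_rpow hδ hγ0 hγ
  set B : ℝ → Set X := fun ε => Metric.ball ζ ε with hB
  set A : ℝ → Set X := fun ε => ZeroHole.annulus f (B ε) q with hAdef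
  have hA : ∀ ε, MeasurableSet (A ε) := fun ε =>
    ZeroHole.measurableSet_annulus hf.measurable measurableSet_ball q
  have hM0 : 0 ≤ M := by
    obtain ⟨φ, -, h⟩ := hM 1 one_pos
    exact (norm_nonneg φ).trans h
  have hmix : ∀ᶠ ε in 𝓝[>] (0 : ℝ), ∀ V : Set X, MeasurableSet V → ∀ n, 1 ≤ n →
      |P.real (A ε ∩ f^[n] ⁻¹' V) - P.real (A ε) * P.real V| ≤ M * γ n * P.real V := by
    filter_upwards [self_mem_nhdsWithin] with ε hε V hV n hn
    obtain ⟨φ, h1, h2⟩ := hM ε hε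
    exact hdecay.abs_measureReal_inter_sub_le hf (hA ε) hV h1 h2 hn
  have hBpos : ∀ᶠ ε in 𝓝[>] (0 : ℝ), 0 < P.real (B ε) := by
    filter_upwards [self_mem_nhdsWithin] with ε hε
    exact ENNReal.toReal_pos (hζ ε hε).ne' (measure_ne_top _ _)
  refine EReal.ge_of_forall_gt_iff_ge.1 fun c hcθ => ?_
  have hc : c < θ := by exact_mod_cast hcθ
  refine le_liminf_of_le (h := ?_)
  -- For `c ≤ 0` nonnegativity of the escape rate suffices. For `c > 0` also `θ > 0`, which makes `P
  -- (A ε)` positive for small `ε`.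
  rcases le_or_gt c 0 with hc0 | hc0
  · refine Eventually.of_forall fun ε => ?_
    refine le_trans (by exact_mod_cast hc0) (EReal.mul_nonneg ?_ (ZeroHole.escapeRate_nonneg _))
    exact_mod_cast (by positivity : 0 ≤ 1 / P.real (Metric.ball ζ ε))
  have hApos : ∀ᶠ ε in 𝓝[>] (0 : ℝ), 0 < P.real (A ε) := by
    filter_upwards [hθ.eventually_const_lt (hc0.trans hc), hBpos] with ε h1 h2
    exact (div_pos_iff_of_pos_right h2).1 h1
  obtain ⟨K, hK, hKc⟩ : ∃ K : ℕ, 5 ≤ K ∧ c < θ * (((K : ℝ) - 5) / (K + 1)) := by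
    -- `(K - 5) / (K + 1) = 1 - 6 / (K + 1)`.
    have h1 : Tendsto (fun K : ℕ => θ * (1 - 6 * (1 / ((K : ℝ) + 1)))) atTop (𝓝 θ) := by
      simpa using ((tendsto_one_div_add_atTop_nhds_zero_nat (𝕜 := ℝ)).const_mul 6).const_sub 1
        |>.const_mul θ
    obtain ⟨K, h2, h3⟩ := ((h1.eventually_const_lt hc).and (eventually_ge_atTop 5)).exists
    refine ⟨K, h3, h2.trans_eq ?_⟩
    field_simp
    ring
  filter_upwards [ZeroHole.eventually_le_escapeRate hf hγ0 hdecay.antitone hsum hnγ hA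
    (fun ε => Set.inter_subset_left) hq.1 hM0 hmix hApos hK,
    (hθ.mul_const (((K : ℝ) - 5) / (K + 1))).eventually_const_lt hKc, hBpos] with ε h1 h2 h3
  calc (c : EReal)
      ≤ ((1 / P.real (B ε) * (P.real (A ε) * (((K : ℝ) - 5) / (K + 1))) : ℝ) : EReal) := by
        refine EReal.coe_le_coe_iff.2 (h2.le.trans_eq ?_)
        simp only [hAdef, hB]
        ring
    _ = ((1 / P.real (B ε) : ℝ) : EReal) *
        ((P.real (A ε) * (((K : ℝ) - 5) / (K + 1)) : ℝ) : EReal) := EReal.coe_mul _ _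
    _ ≤ _ := mul_le_mul_of_nonneg_left h1
        (by exact_mod_cast (by positivity : 0 ≤ 1 / P.real (B ε)))
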